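/- Let $(X_t)_{t\ge 0}$ be a continuous-time, time-homogeneous Markov process with countable state space $S$ and transition probabilities $p_t(x,y)$, $x,y\in S$, started in a state $i\in S$. Let $$L_t=\int_0^t \mathbf 1_{\{X_s=i\}}\,ds ,\qquad G_\infty=\int_0^\infty p_t(i,i)\,dt$$ be the local time of $X$ in $i$ and the Green function at $(i,i)$. Suppose that $G_\infty<\infty$ and let $0<\kappa<1/G_\infty$ (with $1/0=\infty$). Then $$\lim_{t\to\infty}\mathbb E\big[e^{\kappa L_t}\big]=\frac{1}{1-\kappa G_\infty}.$$ -/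

import Mathlib

open MeasureTheory ProbabilityTheory Filter Topology
open scoped NNReal ENNReal

/-- A time-homogeneous transition function `p_t(x, ·) = P t x` on `S`: probability kernels with
`p_0 = id` that satisfy the Chapman–Kolmogorov equations. -/
structure IsTransitionFunction {S : Type*} [MeasurableSpace S]
    (P : ℝ≥0 → Kernel S S) : Prop where
  isMarkovKernel : ∀ t, IsMarkovKernel (P t)
  zero : P 0 = Kernel.id
  chapman_kolmogorov : ∀ s t, P (s + t) = P t ∘ₖ P s

/-- The σ-algebra `σ(X_u : u ≤ s)` generated by the process up to time `s`. -/
abbrev pastSigmaAlgebra {S Ω : Type*} [MeasurableSpace S] (X : ℝ≥0 → Ω → S) (s : ℝ≥0) :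
    MeasurableSpace Ω :=
  ⨆ u ∈ Set.Iic s, MeasurableSpace.comap (X u) inferInstance

/-- `X` is, under `μ`, a continuous-time, time-homogeneous Markov process on the countable set `S`
with transition function `P`, started in `i`. The last field is the Markov property
`μ(X_{s+t} = y | σ(X_u : u ≤ s)) = p_t(X_s, y)`, written on the atoms `{X_s = x}`.
Right-continuous paths imply the joint measurability that is asked for. -/
structure IsMarkovProcessFrom {S Ω : Type*} [MeasurableSpace S] [MeasurableSpace Ω]
    (P : ℝ≥0 → Kernel S S) (μ : Measure Ω) (i : S) (X : ℝ≥0 → Ω → S) : Prop where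
  transition : IsTransitionFunction P
  measurable : Measurable (Function.uncurry X)
  start : ∀ᵐ ω ∂μ, X 0 ω = i
  markov : ∀ (s t : ℝ≥0) (A : Set Ω), MeasurableSet[pastSigmaAlgebra X s] A → ∀ x y : S,
    μ (A ∩ {ω | X s ω = x} ∩ {ω | X (s + t) ω = y}) = μ (A ∩ {ω | X s ω = x}) * P t x {y}

/-- The Green function on the diagonal, `G_∞(i,i) = ∫_0^∞ p_t(i,i) dt`. -/
noncomputable def greenDiag {S : Type*} [MeasurableSpace S] (P : ℝ≥0 → Kernel S S) (i : S) :
    ℝ≥0∞ :=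
  ∫⁻ t in Set.Ioi (0 : ℝ), P t.toNNReal i {i}

/-- The local time in `i` up to time `t`, `L_t = ∫_0^t δ_i(X_s) ds`, where `δ_i(x)` is `1` for
`x = i` and `0` otherwise. -/
noncomputable def localTime {S Ω : Type*} (X : ℝ≥0 → Ω → S) (i : S) (t : ℝ) (ω : Ω) : ℝ :=
  ∫ s in (0 : ℝ)..t, Set.indicator {i} (fun _ => (1 : ℝ)) (X s.toNNReal ω)

/-!
Let `ν` be the random measure on the time axis given by Lebesgue measure on the visits of `X` to
`i`, so that `L_t = ν(-∞, t]`, and let `L_∞` be its total mass. Since `ν` has no atoms,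
`L_∞ ^ (n + 1) = (n + 1) ∫ L_u ^ n dν(u)` and `L_∞ ^ (n + 2)` is `(n + 1) (n + 2)` times
`∫ L_u ^ n (L_∞ - L_u) dν(u)`. The Markov property at a time `u` with `X_u = i` makes the remaining
time `L_∞ - L_u` conditionally independent of the past, with mean `G_∞`, hence
`E[L_∞ ^ (n + 2)] = (n + 2) G_∞ E[L_∞ ^ (n + 1)]` and `E[L_∞ ^ n] = n! G_∞ ^ n`, the moments of an
exponential law of mean `G_∞`. Summing the exponential series gives
`E[exp (κ L_∞)] = ∑ (κ G_∞) ^ n`, and `E[exp (κ L_t)]` increases to it by monotone convergence. With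
values in `[0, ∞]` no integrability has to be checked on the way.
-/

section Tonelli

theorem lintegral_setLIntegral_swap {α β : Type*} [MeasurableSpace α] [MeasurableSpace β]
    {μ : Measure α} {ν : Measure β} [SFinite μ] [SFinite ν] {T : Set (α × β)}
    (hT : MeasurableSet T) {f : α → β → ℝ≥0∞} (hf : Measurable (Function.uncurry f)) :
    ∫⁻ x, ∫⁻ y in Prod.mk x ⁻¹' T, f x y ∂ν ∂μ
      = ∫⁻ y, ∫⁻ x in (·, y) ⁻¹' T, f x y ∂μ ∂ν := by
  simp_rw [← lintegral_indicator (measurable_prodMk_left hT),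
    ← lintegral_indicator (measurable_prodMk_right hT)]
  exact lintegral_lintegral_swap (hf.indicator hT).aemeasurable

/-- The function `ω ↦ ν {a | (a, ω) ∈ T}` need not be `m`-measurable, since `T` is not assumed to be
measurable for the product of `m` with the σ-algebra of `α`. Its powers are therefore unfolded with
Tonelli's theorem, one section of `T` at a time. -/
theorem lintegral_measure_section_pow_congr {α Ω : Type*} [MeasurableSpace α]
    {m : MeasurableSpace Ω} [MeasurableSpace Ω] {ν : Measure α} [SFinite ν] {T : Set (α × Ω)}
    (hT : MeasurableSet T) (hTm : ∀ a, MeasurableSet[m] (Prod.mk a ⁻¹' T)) (n : ℕ)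
    {μ₁ μ₂ : Measure Ω} [SFinite μ₁] [SFinite μ₂] (h : ∀ A, MeasurableSet[m] A → μ₁ A = μ₂ A) :
    ∫⁻ ω, ν ((·, ω) ⁻¹' T) ^ n ∂μ₁ = ∫⁻ ω, ν ((·, ω) ⁻¹' T) ^ n ∂μ₂ := by
  induction n generalizing μ₁ μ₂ with
  | zero => simpa using h _ (@MeasurableSet.univ _ m)
  | succ n ih =>
    have hmeas : Measurable fun ω => ν ((·, ω) ⁻¹' T) ^ n :=
      (measurable_measure_prodMk_right hT).pow_const n
    have key (μ : Measure Ω) [SFinite μ] : ∫⁻ ω, ν ((·, ω) ⁻¹' T) ^ (n + 1) ∂μ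
        = ∫⁻ a, ∫⁻ ω in Prod.mk a ⁻¹' T, ν ((·, ω) ⁻¹' T) ^ n ∂μ ∂ν := by
      rw [lintegral_setLIntegral_swap hT (f := fun _ ω => ν ((·, ω) ⁻¹' T) ^ n)
        (hmeas.comp measurable_snd)]
      simp_rw [setLIntegral_const, ← pow_succ]
    rw [key, key]
    refine lintegral_congr fun a => ih fun A hA => ?_
    have ha : MeasurableSet (Prod.mk a ⁻¹' T) := measurable_prodMk_left hT
    have hAa : MeasurableSet[m] (A ∩ Prod.mk a ⁻¹' T) := @MeasurableSet.inter _ m _ _ hA (hTm a)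
    rw [Measure.restrict_apply' ha, Measure.restrict_apply' ha, h _ hAa]

end Tonelli

section AtomlessMeasure

variable {α : Type*} [MeasurableSpace α] [LinearOrder α] [TopologicalSpace α]
  [OrderClosedTopology α] [BorelSpace α] (ν : Measure α)

theorem setLIntegral_Iio_measure_Iic_pow [NullSingletonClass ν] (n : ℕ) (v : α) :
    ∫⁻ u in Set.Iio v, ν (Set.Iic u) ^ n ∂ν
      = ∫⁻ u, ν.restrict (Set.Iic v) (Set.Iic u) ^ n ∂ν.restrict (Set.Iic v) := by
  rw [Measure.restrict_congr_set Iio_ae_eq_Iic]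
  refine setLIntegral_congr_fun measurableSet_Iic fun u hu => ?_
  rw [Measure.restrict_apply measurableSet_Iic, Set.inter_eq_left.2 (Set.Iic_subset_Iic.2 hu)]

theorem measurable_measure_Iic : Measurable fun u => ν (Set.Iic u) :=
  Monotone.measurable fun _ _ hab => measure_mono (Set.Iic_subset_Iic.2 hab)

variable [SecondCountableTopology α] [SFinite ν]

theorem lintegral_mul_measure_Ioi {f : α → ℝ≥0∞} (hf : Measurable f) :
    ∫⁻ u, f u * ν (Set.Ioi u) ∂ν = ∫⁻ v, ∫⁻ u in Set.Iio v, f u ∂ν ∂ν := by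
  simp_rw [← setLIntegral_const]
  exact lintegral_setLIntegral_swap (measurableSet_lt measurable_fst measurable_snd)
    (hf.comp measurable_fst)

variable [NullSingletonClass ν]

theorem measure_univ_pow_succ (n : ℕ) :
    ν Set.univ ^ (n + 1) = (n + 1) * ∫⁻ u, ν (Set.Iic u) ^ n ∂ν := by
  induction n generalizing ν with
  | zero => simp
  | succ n ih =>
    have hmeas : Measurable fun u => ν (Set.Iic u) := measurable_measure_Iic ν
    have hIio (v : α) : (n + 1) * ∫⁻ u in Set.Iio v, ν (Set.Iic u) ^ n ∂ν
        = ν (Set.Iic v) ^ (n + 1) := by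
      rw [setLIntegral_Iio_measure_Iic_pow, ← ih, Measure.restrict_apply_univ]
    have hsplit (u : α) : ν (Set.Iic u) ^ n * ν Set.univ
        = ν (Set.Iic u) ^ (n + 1) + ν (Set.Iic u) ^ n * ν (Set.Ioi u) := by
      rw [← Set.compl_Iic, pow_succ, ← mul_add, measure_add_measure_compl measurableSet_Iic]
    calc ν Set.univ ^ (n + 1 + 1)
        = (n + 1) * ∫⁻ u, ν (Set.Iic u) ^ n * ν Set.univ ∂ν := by
          rw [pow_succ, ih ν, lintegral_mul_const _ (hmeas.pow_const n), mul_assoc]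
      _ = (n + 1) * ∫⁻ u, ν (Set.Iic u) ^ (n + 1) ∂ν
          + ∫⁻ v, (n + 1) * ∫⁻ u in Set.Iio v, ν (Set.Iic u) ^ n ∂ν ∂ν := by
          simp_rw [hsplit]
          rw [lintegral_add_left (hmeas.pow_const _), mul_add,
            lintegral_mul_measure_Ioi ν (hmeas.pow_const n),
            lintegral_const_mul' _ _ (by finiteness)]
      _ = (↑(n + 1) + 1) * ∫⁻ u, ν (Set.Iic u) ^ (n + 1) ∂ν := by
          simp_rw [hIio]
          push_cast
          ring

theorem lintegral_measure_Iic_pow_succ (n : ℕ) :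
    ∫⁻ v, ν (Set.Iic v) ^ (n + 1) ∂ν
      = (n + 1) * ∫⁻ u, ν (Set.Iic u) ^ n * ν (Set.Ioi u) ∂ν := by
  rw [lintegral_mul_measure_Ioi ν ((measurable_measure_Iic ν).pow_const n),
    ← lintegral_const_mul' _ _ (by finiteness)]
  refine lintegral_congr fun v => ?_
  rw [setLIntegral_Iio_measure_Iic_pow, ← measure_univ_pow_succ,
    Measure.restrict_apply_univ]

end AtomlessMeasure

theorem ereal_exp_coe_ennreal_eq_tsum (x : ℝ≥0∞) :
    EReal.exp x = ∑' n : ℕ, x ^ n / n.factorial := by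
  rcases eq_or_ne x ∞ with rfl | hx
  · have h : (∞ : ℝ≥0∞) ^ 1 / (1 : ℕ).factorial ≤ ∑' n : ℕ, ∞ ^ n / n.factorial :=
      ENNReal.le_tsum 1
    simpa [eq_comm] using h
  · lift x to ℝ≥0 using hx
    have hs : HasSum (fun n : ℕ => (x : ℝ) ^ n / n.factorial) (Real.exp x) := by
      rw [Real.exp_eq_exp_ℝ]
      exact NormedSpace.expSeries_div_hasSum_exp (x : ℝ)
    have hexp : EReal.exp (x : ℝ≥0∞) = ENNReal.ofReal (Real.exp x) := EReal.exp_coe x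
    rw [hexp, ← hs.tsum_eq, ENNReal.ofReal_tsum_of_nonneg (fun n => by positivity) hs.summable]
    refine tsum_congr fun n => ?_
    rw [ENNReal.ofReal_div_of_pos (by positivity), ENNReal.ofReal_pow (by positivity),
      ENNReal.ofReal_natCast, ENNReal.ofReal_coe_nnreal]

theorem lintegral_exp_mul_of_moments {Ω : Type*} [MeasurableSpace Ω] {μ : Measure Ω}
    {f : Ω → ℝ≥0∞} (hf : Measurable f) {a : ℝ≥0∞}
    (hmoments : ∀ n : ℕ, ∫⁻ ω, f ω ^ n ∂μ = n.factorial * a ^ n) (c : ℝ≥0∞) :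
    ∫⁻ ω, EReal.exp (c * f ω : ℝ≥0∞) ∂μ = (1 - c * a)⁻¹ := by
  calc ∫⁻ ω, EReal.exp (c * f ω : ℝ≥0∞) ∂μ
      = ∫⁻ ω, ∑' n : ℕ, c ^ n / n.factorial * f ω ^ n ∂μ := by
        simp_rw [ereal_exp_coe_ennreal_eq_tsum, mul_pow, ENNReal.mul_div_right_comm]
    _ = ∑' n : ℕ, c ^ n / n.factorial * (n.factorial * a ^ n) := by
        rw [lintegral_tsum fun n => ((hf.pow_const n).const_mul _).aemeasurable]
        simp_rw [lintegral_const_mul _ (hf.pow_const _), hmoments]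
    _ = ∑' n : ℕ, (c * a) ^ n := by
        refine tsum_congr fun n => ?_
        rw [← mul_assoc, ENNReal.div_mul_cancel (by positivity) (by finiteness), mul_pow]
    _ = (1 - c * a)⁻¹ := ENNReal.tsum_geometric _

theorem tendsto_lintegral_atTop_of_monotone {ι Ω : Type*} [SemilatticeSup ι] [Nonempty ι]
    [(atTop : Filter ι).IsCountablyGenerated] [MeasurableSpace Ω] {μ : Measure Ω}
    {f : ι → Ω → ℝ≥0∞} {F : Ω → ℝ≥0∞} (hf : ∀ t, Measurable (f t)) (hmono : Monotone f)
    (hlim : ∀ ω, Tendsto (fun t => f t ω) atTop (𝓝 (F ω))) :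
    Tendsto (fun t => ∫⁻ ω, f t ω ∂μ) atTop (𝓝 (∫⁻ ω, F ω ∂μ)) := by
  obtain ⟨φ, hφ, hφ_top⟩ := exists_seq_monotone_tendsto_atTop_atTop ι
  have hmono_lintegral : Monotone fun t => ∫⁻ ω, f t ω ∂μ := fun _ _ h =>
    lintegral_mono (hmono h)
  have hseq : Tendsto (fun k => ∫⁻ ω, f (φ k) ω ∂μ) atTop (𝓝 (∫⁻ ω, F ω ∂μ)) :=
    lintegral_tendsto_of_tendsto_of_monotone (fun k => (hf (φ k)).aemeasurable)
      (ae_of_all _ fun ω _ _ h => hmono (hφ h) ω) (ae_of_all _ fun ω => (hlim ω).comp hφ_top)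
  have hsup := tendsto_atTop_iSup hmono_lintegral
  rwa [tendsto_nhds_unique (hsup.comp hφ_top) hseq] at hsup

theorem toReal_inv_one_sub_ofReal_mul {c : ℝ} (hc : 0 ≤ c) {a : ℝ≥0∞}
    (h : ENNReal.ofReal c * a ≤ 1) :
    (1 - ENNReal.ofReal c * a)⁻¹.toReal = 1 / (1 - c * a.toReal) := by
  rw [ENNReal.toReal_inv, ENNReal.toReal_sub_of_le h ENNReal.one_ne_top, ENNReal.toReal_one,
    ENNReal.toReal_mul, ENNReal.toReal_ofReal hc, one_div]

section OccupationMeasure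

variable {S Ω : Type*} {X : ℝ≥0 → Ω → S} {i : S}

/-- The graph of the visits of `X` to `i`: its section at a time `s` is the event `{X_s = i}`, its
section at `ω` the set of times that the path `ω` spends in `i`. The times `s ≤ 0`, at which
`s.toNNReal` would be `0`, are left out. -/
def visitSet (X : ℝ≥0 → Ω → S) (i : S) : Set (ℝ × Ω) :=
  {q | 0 < q.1 ∧ X q.1.toNNReal q.2 = i}

/-- The occupation measure of `i`, whose distribution function is the local time with values in
`ℝ≥0∞` and whose total mass is the total time `L_∞` spent in `i`. -/
noncomputable def occupationMeasure (X : ℝ≥0 → Ω → S) (i : S) (ω : Ω) : Measure ℝ :=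
  volume.restrict ((·, ω) ⁻¹' visitSet X i)

instance (ω : Ω) : SFinite (occupationMeasure X i ω) :=
  inferInstanceAs (SFinite (volume.restrict _))

instance (ω : Ω) : NullSingletonClass (occupationMeasure X i ω) :=
  inferInstanceAs (NullSingletonClass (volume.restrict _))

theorem prodMk_preimage_visitSet_of_pos {s : ℝ} (hs : 0 < s) :
    Prod.mk s ⁻¹' visitSet X i = {ω | X s.toNNReal ω = i} := by
  ext; simp [visitSet, hs]

theorem prodMk_preimage_visitSet_of_nonpos {s : ℝ} (hs : s ≤ 0) :
    Prod.mk s ⁻¹' visitSet X i = ∅ := by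
  ext; simp [visitSet, hs.not_gt]

theorem occupationMeasure_Iic_ne_top (t : ℝ) (ω : Ω) :
    occupationMeasure X i ω (Set.Iic t) ≠ ∞ := by
  refine ne_top_of_le_ne_top (measure_Icc_lt_top (μ := volume) (a := (0 : ℝ)) (b := t)).ne ?_
  rw [occupationMeasure, Measure.restrict_apply measurableSet_Iic]
  exact measure_mono fun s hs => ⟨hs.2.1.le, hs.1⟩

variable [MeasurableSpace S] [MeasurableSingletonClass S]

theorem measurableSet_pastSigmaAlgebra_visitSet {v u : ℝ} (hvu : v ≤ u) :
    MeasurableSet[pastSigmaAlgebra X u.toNNReal] (Prod.mk v ⁻¹' visitSet X i) := by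
  rcases le_or_gt v 0 with hv | hv
  · rw [prodMk_preimage_visitSet_of_nonpos hv]
    exact @MeasurableSet.empty _ (pastSigmaAlgebra X u.toNNReal)
  · rw [prodMk_preimage_visitSet_of_pos hv]
    have hle : MeasurableSpace.comap (X v.toNNReal) inferInstance
        ≤ pastSigmaAlgebra X u.toNNReal :=
      le_iSup₂_of_le v.toNNReal (Real.toNNReal_le_toNNReal hvu) le_rfl
    exact hle _ ⟨{i}, measurableSet_singleton i, rfl⟩

variable [MeasurableSpace Ω]

theorem measurableSet_visitSet (hX : Measurable (Function.uncurry X)) :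
    MeasurableSet (visitSet X i) :=
  (measurableSet_lt measurable_const measurable_fst).inter
    (hX.comp (measurable_real_toNNReal.prodMap measurable_id) (measurableSet_singleton i))

theorem localTime_eq_toReal_occupationMeasure_Iic (hX : Measurable (Function.uncurry X)) {t : ℝ}
    (ht : 0 ≤ t) (ω : Ω) :
    localTime X i t ω = (occupationMeasure X i ω (Set.Iic t)).toReal := by
  have hvisit : MeasurableSet {s : ℝ | X s.toNNReal ω = i} :=
    (hX.comp (measurable_prodMk_right.comp measurable_real_toNNReal)) (measurableSet_singleton i)
  have hindicator : (fun s : ℝ => Set.indicator {i} (fun _ => (1 : ℝ)) (X s.toNNReal ω))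
      = {s : ℝ | X s.toNNReal ω = i}.indicator 1 := rfl
  rw [localTime, intervalIntegral.integral_of_le ht, hindicator, integral_indicator_one hvisit,
    Measure.real, Measure.restrict_apply hvisit, occupationMeasure,
    Measure.restrict_apply measurableSet_Iic]
  congr 2
  ext s
  simp only [visitSet, Set.mem_inter_iff, Set.mem_ofPred_eq, Set.mem_Ioc, Set.mem_Iic,
    Set.mem_preimage]
  tauto

theorem measurable_localTime (hX : Measurable (Function.uncurry X)) (t : ℝ) :
    Measurable (localTime X i t) := by
  have hvisit : Measurable fun q : Ω × ℝ =>
      Set.indicator {i} (fun _ => (1 : ℝ)) (X q.2.toNNReal q.1) :=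
    (measurable_const.indicator (measurableSet_singleton i)).comp
      (hX.comp ((measurable_real_toNNReal.comp measurable_snd).prodMk measurable_fst))
  exact (hvisit.stronglyMeasurable.integral_prod_right.sub
    hvisit.stronglyMeasurable.integral_prod_right).measurable

theorem measurable_occupationMeasure_section (hX : Measurable (Function.uncurry X))
    {Q : Set (ℝ × ℝ)} (hQ : MeasurableSet Q) :
    Measurable fun q : ℝ × Ω => occupationMeasure X i q.2 (Prod.mk q.1 ⁻¹' Q) := by
  have hset : MeasurableSet {r : (ℝ × Ω) × ℝ | (r.1.1, r.2) ∈ Q ∧ (r.2, r.1.2) ∈ visitSet X i} :=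
    ((measurable_fst.fst.prodMk measurable_snd) hQ).inter
      ((measurable_snd.prodMk measurable_fst.snd) (measurableSet_visitSet hX))
  convert measurable_measure_prodMk_left (ν := volume) hset using 2 with q
  exact Measure.restrict_apply (measurable_prodMk_left hQ)

theorem measurable_occupationMeasure_Iic (hX : Measurable (Function.uncurry X)) :
    Measurable fun q : ℝ × Ω => occupationMeasure X i q.2 (Set.Iic q.1) :=
  measurable_occupationMeasure_section hX (measurableSet_le measurable_snd measurable_fst)

theorem measurable_occupationMeasure_Ioi (hX : Measurable (Function.uncurry X)) :
    Measurable fun q : ℝ × Ω => occupationMeasure X i q.2 (Set.Ioi q.1) :=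
  measurable_occupationMeasure_section hX (measurableSet_lt measurable_fst measurable_snd)

theorem measurable_occupationMeasure_univ (hX : Measurable (Function.uncurry X)) :
    Measurable fun ω => occupationMeasure X i ω Set.univ :=
  (measurable_occupationMeasure_section hX .univ).comp (measurable_prodMk_left (x := (0 : ℝ)))

theorem lintegral_setLIntegral_occupationMeasure {μ : Measure Ω} [SFinite μ]
    (hX : Measurable (Function.uncurry X)) {A : Set ℝ} (hA : MeasurableSet A)
    {f : ℝ → Ω → ℝ≥0∞} (hf : Measurable (Function.uncurry f)) :
    ∫⁻ ω, ∫⁻ u in A, f u ω ∂occupationMeasure X i ω ∂μ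
      = ∫⁻ u in A, ∫⁻ ω in Prod.mk u ⁻¹' visitSet X i, f u ω ∂μ := by
  simp_rw [occupationMeasure, Measure.restrict_comm hA]
  exact (lintegral_setLIntegral_swap (measurableSet_visitSet hX) hf).symm

theorem lintegral_lintegral_occupationMeasure {μ : Measure Ω} [SFinite μ]
    (hX : Measurable (Function.uncurry X)) {f : ℝ → Ω → ℝ≥0∞}
    (hf : Measurable (Function.uncurry f)) :
    ∫⁻ ω, ∫⁻ u, f u ω ∂occupationMeasure X i ω ∂μ
      = ∫⁻ u, ∫⁻ ω in Prod.mk u ⁻¹' visitSet X i, f u ω ∂μ := by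
  simpa only [setLIntegral_univ] using lintegral_setLIntegral_occupationMeasure hX .univ hf

end OccupationMeasure

section MarkovProperty

variable {S Ω : Type*} [MeasurableSpace S] [MeasurableSpace Ω] {P : ℝ≥0 → Kernel S S}
  {μ : Measure Ω} {i : S} {X : ℝ≥0 → Ω → S}

namespace IsMarkovProcessFrom

theorem measure_inter_visitSet (hX : IsMarkovProcessFrom P μ i X) {u s : ℝ} (hus : u ≤ s)
    {A : Set Ω} (hA : MeasurableSet[pastSigmaAlgebra X u.toNNReal] A) :
    μ (A ∩ (Prod.mk u ⁻¹' visitSet X i ∩ Prod.mk s ⁻¹' visitSet X i))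
      = P (s - u).toNNReal i {i} * μ (A ∩ Prod.mk u ⁻¹' visitSet X i) := by
  rcases le_or_gt u 0 with hu | hu
  · simp [prodMk_preimage_visitSet_of_nonpos hu]
  · have hmarkov := hX.markov u.toNNReal (s - u).toNNReal A hA i i
    rw [← Real.toNNReal_add hu.le (sub_nonneg.2 hus), add_sub_cancel] at hmarkov
    rw [prodMk_preimage_visitSet_of_pos hu, prodMk_preimage_visitSet_of_pos (hu.trans_le hus),
      ← Set.inter_assoc, hmarkov, mul_comm]

variable [IsProbabilityMeasure μ]

theorem measure_visitSet (hX : IsMarkovProcessFrom P μ i X) {s : ℝ} (hs : 0 < s) :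
    μ (Prod.mk s ⁻¹' visitSet X i) = P s.toNNReal i {i} := by
  have hmarkov := hX.markov 0 s.toNNReal Set.univ .univ i i
  have hstart : {ω | X 0 ω = i} =ᵐ[μ] Set.univ := eventuallyEq_univ.2 hX.start
  rw [Set.univ_inter, zero_add, measure_congr hstart, measure_univ, one_mul] at hmarkov
  rw [← hmarkov, prodMk_preimage_visitSet_of_pos hs]
  exact measure_congr (inter_ae_eq_right_of_ae_eq_univ hstart).symm

theorem lintegral_measure_visitSet (hX : IsMarkovProcessFrom P μ i X) :
    ∫⁻ s, μ (Prod.mk s ⁻¹' visitSet X i) = greenDiag P i := by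
  rw [greenDiag, ← lintegral_indicator measurableSet_Ioi]
  refine lintegral_congr fun s => ?_
  rcases le_or_gt s 0 with hs | hs
  · simp [prodMk_preimage_visitSet_of_nonpos hs, hs]
  · simp [hX.measure_visitSet hs, hs]

theorem setLIntegral_Ioi_measure_visitSet_sub (hX : IsMarkovProcessFrom P μ i X) (u : ℝ) :
    ∫⁻ s in Set.Ioi u, μ (Prod.mk (s - u) ⁻¹' visitSet X i) = greenDiag P i := by
  rw [← hX.lintegral_measure_visitSet,
    ← lintegral_sub_right_eq_self (fun s => μ (Prod.mk s ⁻¹' visitSet X i)) u]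
  refine setLIntegral_eq_of_support_subset fun s hs => ?_
  by_contra hsu
  simp [prodMk_preimage_visitSet_of_nonpos (sub_nonpos.2 (not_lt.1 hsu))] at hs

variable [MeasurableSingletonClass S]

theorem setLIntegral_inter_occupationMeasure_Iic_pow (hX : IsMarkovProcessFrom P μ i X) (n : ℕ)
    {u s : ℝ} (hus : u < s) :
    ∫⁻ ω in Prod.mk u ⁻¹' visitSet X i ∩ Prod.mk s ⁻¹' visitSet X i,
        occupationMeasure X i ω (Set.Iic u) ^ n ∂μ
      = μ (Prod.mk (s - u) ⁻¹' visitSet X i) * ∫⁻ ω in Prod.mk u ⁻¹' visitSet X i,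
        occupationMeasure X i ω (Set.Iic u) ^ n ∂μ := by
  have hvisit : MeasurableSet (visitSet X i) := measurableSet_visitSet hX.measurable
  have hvisit_at (v : ℝ) : MeasurableSet (Prod.mk v ⁻¹' visitSet X i) :=
    measurable_prodMk_left hvisit
  simp_rw [occupationMeasure, Measure.restrict_apply measurableSet_Iic]
  rw [hX.measure_visitSet (sub_pos.2 hus), ← smul_eq_mul, ← lintegral_smul_measure]
  refine lintegral_measure_section_pow_congr (T := Prod.fst ⁻¹' Set.Iic u ∩ visitSet X i)
    (m := pastSigmaAlgebra X u.toNNReal) ((measurable_fst measurableSet_Iic).inter hvisit)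
    (fun v => ?_) n fun A hA => ?_
  · by_cases hv : v ≤ u
    · simpa [Set.preimage_inter, ← Set.preimage_comp, Function.comp_def, hv] using
        measurableSet_pastSigmaAlgebra_visitSet hv
    · simp [Set.preimage_inter, ← Set.preimage_comp, Function.comp_def, hv]
  · rw [Measure.restrict_apply' ((hvisit_at u).inter (hvisit_at s)),
      hX.measure_inter_visitSet hus.le hA, Measure.smul_apply,
      Measure.restrict_apply' (hvisit_at u), smul_eq_mul]

theorem setLIntegral_occupationMeasure_Iic_pow_mul_Ioi (hX : IsMarkovProcessFrom P μ i X) (n : ℕ)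
    (u : ℝ) :
    ∫⁻ ω in Prod.mk u ⁻¹' visitSet X i,
        occupationMeasure X i ω (Set.Iic u) ^ n * occupationMeasure X i ω (Set.Ioi u) ∂μ
      = greenDiag P i * ∫⁻ ω in Prod.mk u ⁻¹' visitSet X i,
        occupationMeasure X i ω (Set.Iic u) ^ n ∂μ := by
  have hvisit_at (v : ℝ) : MeasurableSet (Prod.mk v ⁻¹' visitSet X i) :=
    measurable_prodMk_left (measurableSet_visitSet hX.measurable)
  have hIic : Measurable fun ω => occupationMeasure X i ω (Set.Iic u) ^ n :=
    ((measurable_occupationMeasure_Iic hX.measurable).comp measurable_prodMk_left).pow_const n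
  have hvisit_prob : Measurable fun s => μ (Prod.mk (s - u) ⁻¹' visitSet X i) :=
    (measurable_measure_prodMk_left (measurableSet_visitSet hX.measurable)).comp
      (measurable_id.sub_const u)
  simp_rw [← setLIntegral_const]
  rw [lintegral_setLIntegral_occupationMeasure hX.measurable measurableSet_Ioi
    (f := fun _ ω => occupationMeasure X i ω (Set.Iic u) ^ n) (hIic.comp measurable_snd)]
  simp_rw [Measure.restrict_restrict (hvisit_at _), Set.inter_comm _ (Prod.mk u ⁻¹' visitSet X i)]
  rw [setLIntegral_congr_fun measurableSet_Ioi fun s hs =>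
      hX.setLIntegral_inter_occupationMeasure_Iic_pow n hs,
    lintegral_mul_const _ hvisit_prob, hX.setLIntegral_Ioi_measure_visitSet_sub]

theorem lintegral_lintegral_occupationMeasure_Iic_pow (hX : IsMarkovProcessFrom P μ i X)
    (n : ℕ) :
    ∫⁻ ω, ∫⁻ u, occupationMeasure X i ω (Set.Iic u) ^ n ∂occupationMeasure X i ω ∂μ
      = n.factorial * greenDiag P i ^ (n + 1) := by
  induction n with
  | zero =>
    simp only [pow_zero]
    rw [lintegral_lintegral_occupationMeasure hX.measurable measurable_const]
    simp [hX.lintegral_measure_visitSet]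
  | succ n ih =>
    have hIic : Measurable (Function.uncurry fun u ω => occupationMeasure X i ω (Set.Iic u) ^ n) :=
      (measurable_occupationMeasure_Iic hX.measurable).pow_const n
    have hIoi : Measurable (Function.uncurry fun u ω => occupationMeasure X i ω (Set.Ioi u)) :=
      measurable_occupationMeasure_Ioi hX.measurable
    have hvisit : MeasurableSet (visitSet X i) := measurableSet_visitSet hX.measurable
    have hmoment : Measurable fun u =>
        ∫⁻ ω in Prod.mk u ⁻¹' visitSet X i, occupationMeasure X i ω (Set.Iic u) ^ n ∂μ := by
      simp_rw [← lintegral_indicator (measurable_prodMk_left hvisit)]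
      exact (hIic.indicator hvisit).lintegral_prod_right'
    simp_rw [lintegral_measure_Iic_pow_succ]
    rw [lintegral_const_mul' _ _ (by finiteness),
      lintegral_lintegral_occupationMeasure hX.measurable (f := fun u ω =>
        occupationMeasure X i ω (Set.Iic u) ^ n * occupationMeasure X i ω (Set.Ioi u))
        (hIic.mul hIoi)]
    simp_rw [hX.setLIntegral_occupationMeasure_Iic_pow_mul_Ioi]
    rw [lintegral_const_mul _ hmoment, ← lintegral_lintegral_occupationMeasure hX.measurable hIic,
      ih, Nat.factorial_succ]
    push_cast
    ring

theorem lintegral_occupationMeasure_univ_pow (hX : IsMarkovProcessFrom P μ i X) (n : ℕ) :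
    ∫⁻ ω, occupationMeasure X i ω Set.univ ^ n ∂μ = n.factorial * greenDiag P i ^ n := by
  cases n with
  | zero => simp
  | succ n =>
    simp_rw [measure_univ_pow_succ]
    rw [lintegral_const_mul' _ _ (by finiteness),
      hX.lintegral_lintegral_occupationMeasure_Iic_pow, Nat.factorial_succ]
    push_cast
    ring

theorem lintegral_exp_mul_occupationMeasure_univ (hX : IsMarkovProcessFrom P μ i X) (c : ℝ≥0∞) :
    ∫⁻ ω, EReal.exp (c * occupationMeasure X i ω Set.univ : ℝ≥0∞) ∂μ
      = (1 - c * greenDiag P i)⁻¹ :=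
  lintegral_exp_mul_of_moments (measurable_occupationMeasure_univ hX.measurable)
    hX.lintegral_occupationMeasure_univ_pow c

end IsMarkovProcessFrom

theorem tendsto_lintegral_exp_mul_occupationMeasure_Iic [MeasurableSingletonClass S]
    (hX : Measurable (Function.uncurry X)) {c : ℝ≥0∞} (hc : c ≠ ∞) :
    Tendsto (fun t => ∫⁻ ω, EReal.exp (c * occupationMeasure X i ω (Set.Iic t) : ℝ≥0∞) ∂μ) atTop
      (𝓝 (∫⁻ ω, EReal.exp (c * occupationMeasure X i ω Set.univ : ℝ≥0∞) ∂μ)) := by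
  refine tendsto_lintegral_atTop_of_monotone (fun t => ?_) (fun t t' htt' ω => ?_) fun ω => ?_
  · have hIic : Measurable fun ω => occupationMeasure X i ω (Set.Iic t) :=
      (measurable_occupationMeasure_Iic hX).comp measurable_prodMk_left
    exact EReal.measurable_exp.comp (hIic.const_mul c).coe_ereal_ennreal
  · exact EReal.exp_monotone (EReal.coe_ennreal_le_coe_ennreal_iff.2
      (mul_le_mul_right (measure_mono (Set.Iic_subset_Iic.2 htt')) c))
  · have hIic : Tendsto (fun t => c * occupationMeasure X i ω (Set.Iic t)) atTop
        (𝓝 (c * occupationMeasure X i ω Set.univ)) :=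
      ENNReal.Tendsto.const_mul (tendsto_measure_Iic_atTop _) (.inr hc)
    exact ((ENNReal.continuous_exp.comp continuous_coe_ennreal_ereal).tendsto _).comp hIic

theorem ereal_exp_mul_occupationMeasure_Iic [MeasurableSingletonClass S]
    (hX : Measurable (Function.uncurry X)) {κ t : ℝ} (hκ : 0 ≤ κ) (ht : 0 ≤ t) (ω : Ω) :
    EReal.exp (ENNReal.ofReal κ * occupationMeasure X i ω (Set.Iic t) : ℝ≥0∞)
      = ENNReal.ofReal (Real.exp (κ * localTime X i t ω)) := by
  rw [← EReal.exp_coe, localTime_eq_toReal_occupationMeasure_Iic hX ht,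
    ← EReal.coe_ennreal_toReal (ENNReal.mul_ne_top ENNReal.ofReal_ne_top
      (occupationMeasure_Iic_ne_top t ω)), ENNReal.toReal_mul, ENNReal.toReal_ofReal hκ]

theorem integral_exp_mul_localTime_eq_toReal [MeasurableSingletonClass S]
    (hX : Measurable (Function.uncurry X)) (κ t : ℝ) :
    ∫ ω, Real.exp (κ * localTime X i t ω) ∂μ
      = (∫⁻ ω, ENNReal.ofReal (Real.exp (κ * localTime X i t ω)) ∂μ).toReal :=
  integral_eq_lintegral_of_nonneg_ae (ae_of_all _ fun _ => (Real.exp_pos _).le)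
    ((measurable_localTime hX t).const_mul κ).exp.aestronglyMeasurable

end MarkovProperty

/-- For `κ G_∞ ≥ 1` the truncated subtraction gives `0⁻¹ = ∞`, which is the correct limit: the
geometric series diverges. -/
theorem mainTheorem8_general {S : Type*} [MeasurableSpace S] [MeasurableSingletonClass S]
    {Ω : Type*} [MeasurableSpace Ω] (μ : Measure Ω) [IsProbabilityMeasure μ]
    (P : ℝ≥0 → Kernel S S) (i : S) (X : ℝ≥0 → Ω → S) (hX : IsMarkovProcessFrom P μ i X)
    (κ : ℝ) (hκ : 0 ≤ κ) :
    Tendsto (fun t : ℝ => ∫⁻ ω, ENNReal.ofReal (Real.exp (κ * localTime X i t ω)) ∂μ) atTop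
      (𝓝 (1 - ENNReal.ofReal κ * greenDiag P i)⁻¹) := by
  rw [← hX.lintegral_exp_mul_occupationMeasure_univ]
  refine (tendsto_lintegral_exp_mul_occupationMeasure_Iic hX.measurable
    ENNReal.ofReal_ne_top).congr' ?_
  filter_upwards [eventually_ge_atTop 0] with t ht
  exact lintegral_congr fun ω => ereal_exp_mul_occupationMeasure_Iic hX.measurable hκ ht ω

theorem mainTheorem8 {S : Type*} [Countable S] [MeasurableSpace S] [DiscreteMeasurableSpace S]
    {Ω : Type*} [MeasurableSpace Ω] (μ : Measure Ω) [IsProbabilityMeasure μ]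
    (P : ℝ≥0 → Kernel S S) (i : S) (X : ℝ≥0 → Ω → S) (hX : IsMarkovProcessFrom P μ i X)
    (hG : greenDiag P i < ∞) (κ : ℝ) (hκ : 0 < κ)
    (hκG : ENNReal.ofReal κ < 1 / greenDiag P i) :
    Tendsto (fun t : ℝ => ∫ ω, Real.exp (κ * localTime X i t ω) ∂μ) atTop
      (𝓝 (1 / (1 - κ * (greenDiag P i).toReal))) := by
  have hlt : ENNReal.ofReal κ * greenDiag P i < 1 :=
    (ENNReal.lt_div_iff_mul_lt (.inr ENNReal.ofReal_ne_top) (.inl hG.ne)).1 hκG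
  simp_rw [integral_exp_mul_localTime_eq_toReal hX.measurable,
    ← toReal_inv_one_sub_ofReal_mul hκ.le hlt.le]
  exact (ENNReal.tendsto_toReal (ENNReal.inv_ne_top.2 (tsub_pos_of_lt hlt).ne')).comp
    (mainTheorem8_general μ P i X hX κ hκ.le)
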